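/- Let $\mathcal L$ be a relational language whose relation symbols have bounded arities (for example, a finite relational language), and let $A$ be a finite $\mathcal L$-structure. Let $\mathrm{Part}(A)$ be the set of all partial automorphisms of $A$, that is, of all isomorphisms $p:U\to V$ between (induced, possibly empty) substructures $U,V$ of $A$, and for a structure $B$ let $\mathrm{Aut}(B)$ be its automorphism group. Then there are a finite $\mathcal L$-structure $B$ containing $A$ as a substructure and a map $\phi:\mathrm{Part}(A)\to\mathrm{Aut}(B)$ such that (i) $\phi(p)$ extends $p$ for every $p\in\mathrm{Part}(A)$; (ii) $\phi$ is coherent: whenever $p_1,p_2,q\in\mathrm{Part}(A)$ satisfy $\mathrm{dom}(p_2)=\mathrm{dom}(q)$, $\mathrm{range}(p_1)=\mathrm{range}(q)$, $\mathrm{range}(p_2)=\mathrm{dom}(p_1)$ and $q=p_1\circ p_2$, then $\phi(q)=\phi(p_1)\circ\phi(p_2)$; (iii) $B$ is a Gaifman clique faithful extension of $A$: for every clique $Q$ of the Gaifman graph of $B$ there is $g\in\mathrm{Aut}(B)$ with $g(Q)\subseteq A$. Here the Gaifman graph of $B$ has vertex set $B$, and two distinct elements $u,v\in B$ are adjacent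 if and only if there are a relation symbol $R\in\mathcal L$, of arity $n$ say, and a tuple $(a_1,\dots,a_n)\in B^n$ such that $u,v\in\{a_1,\dots,a_n\}$ and $B\models R(a_1,\dots,a_n)$. A clique is a (possibly empty) set of pairwise adjacent elements. In particular, (iii) applies to every substructure $Q$ of $B$ such that any two distinct elements of $Q$ occur together in a tuple from $Q$ satisfying some relation symbol of $\mathcal L$. -/

import Mathlib

open FirstOrder

universe u v w w'

namespace CoherentEPPA

open FirstOrder.Language FirstOrder.Language.Structure

/-- A coherent triple `(p₁, p₂, q)` of partial automorphisms of `M` (elements of `Part(M)`, that is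
isomorphisms between substructures of `M`): `dom p₂ = dom q`, `range p₁ = range q`,
`range p₂ = dom p₁` and `q = p₁ ∘ p₂`. -/
structure IsCoherentTriple {L : FirstOrder.Language.{u, v}} {M : Type w} [L.Structure M]
    (p₁ p₂ q : M ≃ₚ[L] M) : Prop where
  dom_eq : p₂.dom = q.dom
  cod_eq : p₁.cod = q.cod
  mid_eq : p₂.cod = p₁.dom
  comp_eq : ∀ x : p₂.dom,
    (q.toEquiv ⟨x, dom_eq ▸ x.2⟩ : M) = p₁.toEquiv ⟨p₂.toEquiv x, mid_eq ▸ (p₂.toEquiv x).2⟩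

/-- A map `φ : Part(A) → Aut(B)` is coherent if it sends coherent triples to coherent triples.
Elements of `Aut(B)` have domain and range `B`, so a triple of them is coherent exactly if the
third is the composition of the first two. -/
def IsCoherent {L : FirstOrder.Language.{u, v}} {A : Type w} {B : Type w'} [L.Structure A] [L.Structure B]
    (φ : (A ≃ₚ[L] A) → (B ≃[L] B)) : Prop :=
  ∀ p₁ p₂ q : A ≃ₚ[L] A, IsCoherentTriple p₁ p₂ q → φ q = (φ p₁).comp (φ p₂)

/-- With `A` viewed as a substructure of `B` through the embedding `ι`, the automorphism `g` of `B`
extends the partial automorphism `p` of `A`. -/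
def Extends {L : FirstOrder.Language.{u, v}} {A : Type w} {B : Type w'} [L.Structure A] [L.Structure B]
    (ι : A ↪[L] B) (p : A ≃ₚ[L] A) (g : B ≃[L] B) : Prop :=
  ∀ x : p.dom, g (ι x) = ι (p.toEquiv x)

/-- The Gaifman graph of `M`: two distinct elements are adjacent if and only if they both occur in
some tuple satisfying some relation symbol of `L`. -/
def gaifmanGraph (L : FirstOrder.Language.{u, v}) (M : Type w) [L.Structure M] : SimpleGraph M where
  Adj x y := x ≠ y ∧ ∃ (n : ℕ) (R : L.Relations n) (a : Fin n → M),
    x ∈ Set.range a ∧ y ∈ Set.range a ∧ RelMap R a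
  symm := ⟨fun _ _ ⟨h, n, R, a, hx, hy, hR⟩ => ⟨h.symm, n, R, a, hy, hx, hR⟩⟩
  loopless := ⟨fun _ h => h.1 rfl⟩

/-- The extension `ι : A ↪[L] B` is Gaifman clique faithful: every set of pairwise adjacent vertices
of the Gaifman graph of `B` is sent into `A` by some automorphism of `B`. This includes every
substructure of `B` whose own Gaifman graph is complete: see
`IsGaifmanCliqueFaithful.of_substructure`. -/
def IsGaifmanCliqueFaithful {L : FirstOrder.Language.{u, v}} {A : Type w} {B : Type w'} [L.Structure A]
    [L.Structure B] (ι : A ↪[L] B) : Prop :=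
  ∀ Q : Set B, (gaifmanGraph L B).IsClique Q → ∃ g : B ≃[L] B, g '' Q ⊆ Set.range ι

theorem IsGaifmanCliqueFaithful.of_substructure {L : FirstOrder.Language.{u, v}} {A : Type w} {B : Type w'}
    [L.Structure A] [L.Structure B] {ι : A ↪[L] B} (h : IsGaifmanCliqueFaithful ι)
    (Q : L.Substructure B) (hQ : gaifmanGraph L Q = ⊤) :
    ∃ g : B ≃[L] B, g '' (Q : Set B) ⊆ Set.range ι := by
  refine h Q fun x hx y hy hxy => ⟨hxy, ?_⟩
  have hadj : (gaifmanGraph L Q).Adj ⟨x, hx⟩ ⟨y, hy⟩ := by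
    rw [hQ]; exact fun e => hxy (congrArg Subtype.val e)
  obtain ⟨-, n, R, a, ⟨i, hi⟩, ⟨j, hj⟩, hR⟩ := hadj
  exact ⟨n, R, fun k => (a k : B), ⟨i, congrArg Subtype.val hi⟩, ⟨j, congrArg Subtype.val hj⟩, hR⟩

end CoherentEPPA

/-!
The extension is built in two steps, each of which decorates the points of the old set with
finitely many labels from finite sets.

The first step produces a finite extension `C` of `A` in which partial automorphisms extend
coherently. A point of `C` is an element of `A` with switches in `ZMod 2`, one for each set `X` of
tuples of `A`, each tuple `t` and each position in `t`; a tuple over `t` satisfies `R` if its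
switches for `t` sum to the parity of `t`, which is `0` if `R` holds of `t` in `A` and `1`
otherwise. So `A` is embedded with all switches `0`. A partial automorphism `p` is first extended
to a permutation of `A`, matching the complements of domain and range by fixed enumerations. For a
tuple `t` that leaves `dom p`, the permutation may change the parity, and this is made up for by
switching at a chosen position of `t` outside `dom p`. The switch is the difference of a term that
depends on `range p` only and a term that depends on `dom p` only (`correction`); when maps
compose, the terms of the middle set cancel, whence coherence (`twist_twist`).

The second step applies to every finite extension `C` with this property. Call `S ⊆ C` bad if no
automorphism of `C` moves it into `A`. Points of the extension `B` are points `x` of `C` with a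
value among `|S| - 1` possible ones for each bad `S` containing `x`, and a tuple is in a relation
only if it projects to one in the relation and its distinct entries have distinct projections and
distinct values for each common bad set. A clique of the Gaifman graph is thus pairwise
compatible, and by the pigeonhole principle its projection is not bad
(`not_isBad_image_of_pairwise`). Some automorphism `g` of `C` then moves the projection into `A`,
and `g` lifts to `B` with any prescribed effect on a pairwise compatible set, because a partial
bijection between value sets of equal size can be completed (`liftEquiv`, `liftFun_eq`). The same
lifting applies to the automorphisms of `C` assigned to partial automorphisms of `A`, and it is
coherent since the completion of partial bijections is (`rankExtension_comp`, `liftFun_comp`).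
-/

namespace CoherentEPPA

open FirstOrder.Language FirstOrder.Language.Structure

/-! ### Coherent extension of partial bijections -/

section PartialBijections

variable {V : Type*} {W : Type*} {U : Type*}

theorem exists_rank [Finite V] (S : Set V) :
    ∃ r : V → ℕ, Set.BijOn r Sᶜ (Set.Iio (Sᶜ).ncard) := by
  classical
  let e := Finite.equivFin (Sᶜ : Set V)
  refine ⟨fun v => if h : v ∈ Sᶜ then e ⟨v, h⟩ else 0, ?_, ?_, ?_⟩
  · intro v hv
    simp only [dif_pos hv, Set.mem_Iio]
    exact (e ⟨v, hv⟩).2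
  · intro v hv v' hv' h
    simp only [dif_pos hv, dif_pos hv'] at h
    exact congrArg Subtype.val (e.injective (Fin.ext h))
  · intro i hi
    refine ⟨e.symm ⟨i, hi⟩, (e.symm ⟨i, hi⟩).2, ?_⟩
    simp only [dif_pos (e.symm ⟨i, hi⟩).2, Subtype.coe_eta, Equiv.apply_symm_apply]

/-- A fixed enumeration of the complement of `S`, with irrelevant values on `S`. -/
noncomputable def rank [Finite V] (S : Set V) : V → ℕ := (exists_rank S).choose

theorem rank_bijOn [Finite V] (S : Set V) : Set.BijOn (rank S) Sᶜ (Set.Iio (Sᶜ).ncard) :=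
  (exists_rank S).choose_spec

/-- The domain of a relation, regarded as the graph of a partial map. -/
def relDom (G : V → W → Prop) : Set V := {v | ∃ w, G v w}

/-- The range of a relation, regarded as the graph of a partial map. -/
def relRan (G : V → W → Prop) : Set W := {w | ∃ v, G v w}

/-- The map `e` extends the partial bijection with graph `G` and matches the complement of its
domain with the complement of its range according to the fixed enumerations `rank`. Since the
enumeration of a complement depends on the set alone, this prescription is compatible with
composition. -/
structure IsRankExtension [Finite V] [Finite W] (G : V → W → Prop) (e : V → W) : Prop where
  apply_eq : ∀ v w, G v w → e v = w
  notMem : ∀ v, v ∉ relDom G → e v ∉ relRan G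
  rank_eq : ∀ v, v ∉ relDom G → rank (relRan G) (e v) = rank (relDom G) v

theorem IsRankExtension.unique [Finite V] [Finite W] {G : V → W → Prop} {e e' : V → W}
    (h : IsRankExtension G e) (h' : IsRankExtension G e') : e = e' := by
  funext v
  by_cases hv : v ∈ relDom G
  · obtain ⟨w, hw⟩ := hv
    rw [h.apply_eq v w hw, h'.apply_eq v w hw]
  · exact (rank_bijOn (relRan G)).injOn (h.notMem v hv) (h'.notMem v hv)
      ((h.rank_eq v hv).trans (h'.rank_eq v hv).symm)

theorem IsRankExtension.comp [Finite V] [Finite W] [Finite U] {G : V → W → Prop}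
    {H : W → U → Prop} {e : V → W} {f : W → U} (he : IsRankExtension G e)
    (hf : IsRankExtension H f) (hGH : relRan G = relDom H) :
    IsRankExtension (Relation.Comp G H) (f ∘ e) := by
  have hD : relDom (Relation.Comp G H) = relDom G := by
    ext v
    constructor
    · rintro ⟨u, w, hw, -⟩
      exact ⟨w, hw⟩
    · rintro ⟨w, hw⟩
      obtain ⟨u, hu⟩ : w ∈ relDom H := hGH ▸ ⟨v, hw⟩
      exact ⟨u, w, hw, hu⟩
  have hR : relRan (Relation.Comp G H) = relRan H := by
    ext u
    constructor
    · rintro ⟨v, w, -, hw⟩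
      exact ⟨w, hw⟩
    · rintro ⟨w, hw⟩
      obtain ⟨v, hv⟩ : w ∈ relRan G := hGH ▸ ⟨u, hw⟩
      exact ⟨v, w, hv, hw⟩
  refine ⟨?_, ?_, ?_⟩
  · rintro v u ⟨w, hvw, hwu⟩
    rw [Function.comp_apply, he.apply_eq v w hvw, hf.apply_eq w u hwu]
  · intro v hv
    rw [hD] at hv
    rw [hR]
    exact hf.notMem _ (hGH ▸ he.notMem v hv)
  · intro v hv
    rw [hD] at hv ⊢
    rw [hR, Function.comp_apply, hf.rank_eq _ (hGH ▸ he.notMem v hv), ← hGH, he.rank_eq v hv]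

theorem exists_isRankExtension [Finite V] [Finite W] {G : V → W → Prop}
    (hG : Relator.BiUnique G) (hc : Nat.card V = Nat.card W) :
    ∃ e : V ≃ W, IsRankExtension G e := by
  classical
  have hcard : (relDom G).ncard = (relRan G).ncard := by
    refine Set.ncard_congr (fun v hv => hv.choose) ?_ ?_ ?_
    · intro v hv
      exact ⟨v, hv.choose_spec⟩
    · intro v v' hv hv' h
      have h1 := hv.choose_spec
      rw [h] at h1
      exact hG.1 h1 hv'.choose_spec
    · rintro w ⟨v, hv⟩
      have hv' : v ∈ relDom G := ⟨w, hv⟩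
      exact ⟨v, hv', hG.2 hv'.choose_spec hv⟩
  have hcompl : (relDom G)ᶜ.ncard = (relRan G)ᶜ.ncard := by
    have h1 := Set.ncard_add_ncard_compl (relDom G)
    have h2 := Set.ncard_add_ncard_compl (relRan G)
    omega
  have hex : ∀ v, v ∉ relDom G → ∃ w, w ∉ relRan G ∧ rank (relRan G) w = rank (relDom G) v := by
    intro v hv
    have h := (rank_bijOn (relDom G)).mapsTo hv
    rw [hcompl] at h
    exact (rank_bijOn (relRan G)).surjOn h
  let f : V → W := fun v =>
    if h : v ∈ relDom G then h.choose else (hex v h).choose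
  have hf : IsRankExtension G f := by
    refine ⟨?_, ?_, ?_⟩
    · intro v w hvw
      have hv : v ∈ relDom G := ⟨w, hvw⟩
      simp only [f, dif_pos hv]
      exact hG.2 hv.choose_spec hvw
    · intro v hv
      simp only [f, dif_neg hv]
      exact (hex v hv).choose_spec.1
    · intro v hv
      simp only [f, dif_neg hv]
      exact (hex v hv).choose_spec.2
  have hinj : Function.Injective f := by
    intro v v' h
    by_cases hv : v ∈ relDom G <;> by_cases hv' : v' ∈ relDom G
    · obtain ⟨w, hw⟩ := hv
      obtain ⟨w', hw'⟩ := hv'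
      rw [hf.apply_eq v w hw, hf.apply_eq v' w' hw'] at h
      exact hG.1 hw (h ▸ hw')
    · obtain ⟨w, hw⟩ := hv
      rw [hf.apply_eq v w hw] at h
      exact absurd ⟨v, h ▸ hw⟩ (hf.notMem v' hv')
    · obtain ⟨w, hw⟩ := hv'
      rw [hf.apply_eq v' w hw] at h
      exact absurd ⟨v', h ▸ hw⟩ (hf.notMem v hv)
    · refine (rank_bijOn (relDom G)).injOn hv hv' ?_
      rw [← hf.rank_eq v hv, ← hf.rank_eq v' hv', h]
  exact ⟨Equiv.ofBijective f ((Nat.bijective_iff_injective_and_card f).2 ⟨hinj, hc⟩), hf⟩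

/-- The extension of a partial bijection between finite sets of equal size to a bijection, coherent
in the sense of `rankExtension_comp`. -/
noncomputable def rankExtension [Finite V] [Finite W] (G : V → W → Prop)
    (hG : Relator.BiUnique G) (hc : Nat.card V = Nat.card W) : V ≃ W :=
  (exists_isRankExtension hG hc).choose

theorem isRankExtension_rankExtension [Finite V] [Finite W] {G : V → W → Prop}
    (hG : Relator.BiUnique G) (hc : Nat.card V = Nat.card W) :
    IsRankExtension G (rankExtension G hG hc) :=
  (exists_isRankExtension hG hc).choose_spec

theorem rankExtension_comp [Finite V] [Finite W] [Finite U] {G : V → W → Prop}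
    {H : W → U → Prop} {K : V → U → Prop} (hG : Relator.BiUnique G) (hH : Relator.BiUnique H)
    (hK : Relator.BiUnique K) (hVW : Nat.card V = Nat.card W) (hWU : Nat.card W = Nat.card U)
    (hVU : Nat.card V = Nat.card U) (hGH : relRan G = relDom H) (hcomp : K = Relation.Comp G H)
    (v : V) :
    rankExtension K hK hVU v = rankExtension H hH hWU (rankExtension G hG hVW v) := by
  subst hcomp
  exact congrFun ((isRankExtension_rankExtension hK hVU).unique
    ((isRankExtension_rankExtension hG hVW).comp (isRankExtension_rankExtension hH hWU) hGH)) v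

end PartialBijections

/-! ### Graphs of partial automorphisms -/

section Graphs

variable {L : FirstOrder.Language.{u, v}} {A : Type w} [L.Structure A]

/-- The graph of a partial automorphism, as a relation on the whole structure. -/
def graph (p : A ≃ₚ[L] A) (a b : A) : Prop := ∃ h : a ∈ p.dom, (p.toEquiv ⟨a, h⟩ : A) = b

theorem graph_biUnique (p : A ≃ₚ[L] A) : Relator.BiUnique (graph p) := by
  constructor
  · rintro a a' b ⟨h, rfl⟩ ⟨h', e⟩
    exact (congrArg Subtype.val (p.toEquiv.injective (Subtype.ext e))).symm
  · rintro a b b' ⟨h, rfl⟩ ⟨h', e⟩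
    exact e

theorem relDom_graph (p : A ≃ₚ[L] A) : relDom (graph p) = p.dom := by
  ext a
  exact ⟨fun ⟨_, h, _⟩ => h, fun h => ⟨_, h, rfl⟩⟩

theorem relRan_graph (p : A ≃ₚ[L] A) : relRan (graph p) = p.cod := by
  ext b
  constructor
  · rintro ⟨a, h, rfl⟩
    exact (p.toEquiv ⟨a, h⟩).2
  · intro h
    refine ⟨p.toEquiv.symm ⟨b, h⟩, (p.toEquiv.symm ⟨b, h⟩).2, ?_⟩
    simp

theorem IsCoherentTriple.relRan_eq_relDom {p₁ p₂ q : A ≃ₚ[L] A} (h : IsCoherentTriple p₁ p₂ q) :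
    relRan (graph p₂) = relDom (graph p₁) := by
  rw [relRan_graph, relDom_graph, h.mid_eq]

theorem IsCoherentTriple.graph_eq {p₁ p₂ q : A ≃ₚ[L] A} (h : IsCoherentTriple p₁ p₂ q) :
    graph q = Relation.Comp (graph p₂) (graph p₁) := by
  funext a c
  apply propext
  constructor
  · rintro ⟨ha, rfl⟩
    have ha' : a ∈ p₂.dom := h.dom_eq ▸ ha
    exact ⟨_, ⟨ha', rfl⟩, ⟨h.mid_eq ▸ (p₂.toEquiv ⟨a, ha'⟩).2, (h.comp_eq ⟨a, ha'⟩).symm⟩⟩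
  · rintro ⟨b, ⟨ha, rfl⟩, ⟨hb, rfl⟩⟩
    exact ⟨h.dom_eq ▸ ha, h.comp_eq ⟨a, ha⟩⟩

theorem Extends.apply_eq {B : Type w'} [L.Structure B] {ι : A ↪[L] B} {p : A ≃ₚ[L] A}
    {g : B ≃[L] B} (h : Extends ι p g) {a b : A} (hab : graph p a b) : g (ι a) = ι b := by
  obtain ⟨ha, rfl⟩ := hab
  exact h ⟨a, ha⟩

theorem relMap_iff_of_graph (p : A ≃ₚ[L] A) {n : ℕ} (R : L.Relations n) {s t : Fin n → A}
    (h : ∀ i, graph p (s i) (t i)) : RelMap R t ↔ RelMap R s := by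
  choose hs ht using h
  have := p.toEquiv.map_rel R fun i => ⟨s i, hs i⟩
  have ht' : t = fun i => (p.toEquiv ⟨s i, hs i⟩ : A) := funext fun i => (ht i).symm
  rw [ht']
  exact this

/-- The coherent extension of a partial automorphism to a permutation of the underlying set. -/
noncomputable def permExtension [Finite A] (p : A ≃ₚ[L] A) : Equiv.Perm A :=
  rankExtension (graph p) (graph_biUnique p) rfl

theorem isRankExtension_permExtension [Finite A] (p : A ≃ₚ[L] A) :
    IsRankExtension (graph p) (permExtension p) :=
  isRankExtension_rankExtension _ _

theorem permExtension_comp [Finite A] {p₁ p₂ q : A ≃ₚ[L] A} (h : IsCoherentTriple p₁ p₂ q) :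
    permExtension q = (permExtension p₂).trans (permExtension p₁) :=
  Equiv.ext fun a => rankExtension_comp _ _ _ _ _ _ h.relRan_eq_relDom h.graph_eq a

theorem permExtension_mem_cod_iff [Finite A] (p : A ≃ₚ[L] A) (a : A) :
    permExtension p a ∈ p.cod ↔ a ∈ p.dom := by
  have h := isRankExtension_permExtension p
  constructor
  · intro ha
    by_contra hn
    refine h.notMem a ?_ ?_
    · rwa [relDom_graph]
    · rwa [relRan_graph]
  · intro ha
    rw [h.apply_eq a _ ⟨ha, rfl⟩]
    exact (p.toEquiv ⟨a, ha⟩).2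

end Graphs

/-! ### A coherent extension by switching -/

section Switching

variable {L : FirstOrder.Language.{u, v}} {A : Type w} {N : ℕ}

/-- The points of the first extension of `A`: an element of `A` together with a switch in `ZMod 2`
for each set `X` of tuples of a fixed length, each tuple and each position in it. Switches are
indexed by subsets `X` of `Aⁿ` and not by relation symbols, of which there may be infinitely
many. -/
def SwitchPoint (L : FirstOrder.Language.{u, v}) (A : Type w) {N : ℕ}
    (_ : ∀ n, L.Relations n → n < N + 1) : Type w :=
  A × (∀ n : Fin (N + 1), Set (Fin n → A) → (Fin n → A) → Fin n → ZMod 2)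

variable {hN : ∀ n, L.Relations n → n < N + 1}

instance [Finite A] : Finite (SwitchPoint L A hN) :=
  inferInstanceAs (Finite (A ×
    (∀ n : Fin (N + 1), Set (Fin n → A) → (Fin n → A) → Fin n → ZMod 2)))

open Classical in
/-- The parity attached to a tuple: `0` if it belongs to `X`, and `1` otherwise. -/
noncomputable def parity {n : ℕ} (X : Set (Fin n → A)) (t : Fin n → A) : ZMod 2 :=
  if t ∈ X then 0 else 1

theorem parity_eq_zero {n : ℕ} {X : Set (Fin n → A)} {t : Fin n → A} :
    parity X t = 0 ↔ t ∈ X := by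
  unfold parity
  split_ifs with h <;> simp [h]

theorem parity_congr {n : ℕ} {X Y : Set (Fin n → A)} {s t : Fin n → A} (h : s ∈ X ↔ t ∈ Y) :
    parity X s = parity Y t := by
  unfold parity
  split_ifs with h₁ h₂ h₂
  · rfl
  · exact absurd (h.1 h₁) h₂
  · exact absurd (h.2 h₂) h₁
  · rfl

/-- A tuple satisfies `R` if the sum of the relevant switches is the parity of the projected
tuple. -/
instance [L.IsRelational] [L.Structure A] : L.Structure (SwitchPoint L A hN) where
  funMap f := isEmptyElim f
  RelMap {n} R v :=
    ∑ i, (v i).2 ⟨n, hN n R⟩ {t | RelMap R t} (fun j => (v j).1) i =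
      parity {t | RelMap R t} (fun j => (v j).1)

theorem SwitchPoint.relMap_iff [L.Structure A] [L.IsRelational] {n : ℕ} (R : L.Relations n)
    (v : Fin n → SwitchPoint L A hN) :
    RelMap R v ↔ ∑ i, (v i).2 ⟨n, hN n R⟩ {t | RelMap R t} (fun j => (v j).1) i =
      parity {t | RelMap R t} (fun j => (v j).1) := Iff.rfl

/-- `A` embeds as the set of points whose switches are all `0`. -/
def switchEmbedding [L.Structure A] [L.IsRelational] (hN : ∀ n, L.Relations n → n < N + 1) :
    A ↪[L] SwitchPoint L A hN where
  toFun a := (a, fun _ _ _ _ => 0)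
  inj' _ _ h := congrArg Prod.fst h
  map_fun' f := isEmptyElim f
  map_rel' R t := by
    change ∑ _i : Fin _, (0 : ZMod 2) = parity {t | RelMap R t} t ↔ RelMap R t
    rw [Finset.sum_const_zero, eq_comm, parity_eq_zero]
    rfl

open Classical in
/-- For a tuple `t` not contained in `D`, the parity of `t` placed at a chosen position of `t`
whose entry is outside `D`; no switches otherwise. The value at the point over `x` vanishes unless
`x` is the entry at this position. -/
noncomputable def correction (D : Set A) {n : ℕ} (X : Set (Fin n → A)) (t : Fin n → A) (x : A)
    (i : Fin n) : ZMod 2 :=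
  if h : ∃ j, t j ∉ D then (if i = h.choose ∧ t i = x then parity X t else 0) else 0

theorem correction_of_mem {D : Set A} {n : ℕ} (X : Set (Fin n → A)) (t : Fin n → A) {x : A}
    (hx : x ∈ D) (i : Fin n) : correction D X t x i = 0 := by
  unfold correction
  split_ifs with h h'
  · exact absurd (h'.2 ▸ hx) (h'.1 ▸ h.choose_spec)
  · rfl
  · rfl

theorem sum_correction_of_subset {D : Set A} {n : ℕ} (X : Set (Fin n → A)) {t : Fin n → A}
    (h : ∀ j, t j ∈ D) : ∑ i, correction D X t (t i) i = 0 :=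
  Finset.sum_eq_zero fun i _ => correction_of_mem X t (h i) i

theorem sum_correction_of_not_subset {D : Set A} {n : ℕ} (X : Set (Fin n → A)) {t : Fin n → A}
    (h : ∃ j, t j ∉ D) : ∑ i, correction D X t (t i) i = parity X t := by
  unfold correction
  simp only [dif_pos h, and_true]
  simp

/-- The map induced by a permutation `g` of `A` which carries `D` to `E`. The switches are
transported along `g` and changed by the difference of the corrections for `E` and for `D`; this
difference is a coboundary, which makes the construction multiplicative. -/
noncomputable def twist (hN : ∀ n, L.Relations n → n < N + 1) (g : Equiv.Perm A) (D E : Set A)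
    (v : SwitchPoint L A hN) : SwitchPoint L A hN :=
  (g v.1, fun n X t i => v.2 n X (g.symm ∘ t) i +
    (correction E X t (g v.1) i - correction D X (g.symm ∘ t) v.1 i))

theorem twist_twist (g h : Equiv.Perm A) (D E F : Set A) (v : SwitchPoint L A hN) :
    twist hN g E F (twist hN h D E v) = twist hN (h.trans g) D F v := by
  refine Prod.ext rfl ?_
  funext n X t i
  simp only [twist, Equiv.trans_apply, Equiv.symm_trans_apply, Function.comp_def]
  ring

theorem twist_injective (g : Equiv.Perm A) (D E : Set A) :
    Function.Injective (twist (L := L) hN g D E) := by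
  intro v v' h
  have h1 : v.1 = v'.1 := g.injective (congrArg Prod.fst h)
  refine Prod.ext h1 ?_
  funext n X t i
  have h2 := congrFun (congrFun (congrFun (congrFun (congrArg Prod.snd h) n) X) (g ∘ t)) i
  simpa [twist, h1, ← Function.comp_assoc] using h2

theorem relMap_twist [L.IsRelational] [L.Structure A] [Finite A] (p : A ≃ₚ[L] A)
    {n : ℕ} (R : L.Relations n)
    (v : Fin n → SwitchPoint L A hN) :
    RelMap R (fun i => twist hN (permExtension p) p.dom p.cod (v i)) ↔ RelMap R v := by
  rw [SwitchPoint.relMap_iff, SwitchPoint.relMap_iff]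
  set X : Set (Fin n → A) := {t | RelMap R t} with hX
  set g := permExtension p with hg
  set t : Fin n → A := fun j => (v j).1 with ht
  have hgt : g.symm ∘ (fun j => g (t j)) = t := by
    funext j
    simp
  change ∑ i, ((v i).2 ⟨n, hN n R⟩ X (g.symm ∘ (fun j => g (t j))) i +
      (correction p.cod X (fun j => g (t j)) (g (t i)) i -
        correction p.dom X (g.symm ∘ (fun j => g (t j))) (t i) i)) =
      parity X (fun j => g (t j)) ↔ _
  rw [hgt, Finset.sum_add_distrib, Finset.sum_sub_distrib]
  by_cases h : ∀ j, t j ∈ p.dom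
  · have h' : ∀ j, g (t j) ∈ p.cod := fun j => (permExtension_mem_cod_iff p _).2 (h j)
    have hpar : parity X (fun j => g (t j)) = parity X t := by
      have := relMap_iff_of_graph p R (s := t) (t := fun j => g (t j)) fun j =>
        ⟨h j, ((isRankExtension_permExtension p).apply_eq _ _ ⟨h j, rfl⟩).symm⟩
      have hmem : (fun j => g (t j)) ∈ X ↔ t ∈ X := this
      exact parity_congr hmem
    rw [sum_correction_of_subset (D := p.cod) X (t := fun j => g (t j)) h',
      sum_correction_of_subset (D := p.dom) X h, hpar, sub_zero, add_zero]
  · push Not at h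
    have h' : ∃ j, g (t j) ∉ p.cod :=
      h.imp fun j hj => fun hc => hj ((permExtension_mem_cod_iff p _).1 hc)
    rw [sum_correction_of_not_subset (D := p.cod) X (t := fun j => g (t j)) h',
      sum_correction_of_not_subset (D := p.dom) X h]
    constructor
    · intro e
      linear_combination e
    · intro e
      linear_combination e

/-- The automorphism of the first extension of `A` assigned to a partial automorphism of `A`. -/
noncomputable def switchEquiv [L.IsRelational] [L.Structure A] [Finite A]
    (hN : ∀ n, L.Relations n → n < N + 1) (p : A ≃ₚ[L] A) :
    SwitchPoint L A hN ≃[L] SwitchPoint L A hN where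
  toEquiv := Equiv.ofBijective _
    (Finite.injective_iff_bijective.1 (twist_injective (permExtension p) p.dom p.cod))
  map_fun' f := isEmptyElim f
  map_rel' R v := relMap_twist p R v

theorem extends_switchEquiv [L.IsRelational] [L.Structure A] [Finite A]
    (hN : ∀ n, L.Relations n → n < N + 1) (p : A ≃ₚ[L] A) :
    Extends (switchEmbedding hN) p (switchEquiv hN p) := by
  intro x
  have hx : permExtension p x = p.toEquiv x :=
    (isRankExtension_permExtension p).apply_eq _ _ ⟨x.2, rfl⟩
  refine Prod.ext hx ?_
  funext n X t i
  change 0 + (correction p.cod X t (permExtension p x) i - correction p.dom X _ (x : A) i) = 0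
  rw [correction_of_mem (D := p.dom) X _ x.2,
    correction_of_mem (D := p.cod) X _ (hx ▸ (p.toEquiv x).2)]
  simp

theorem isCoherent_switchEquiv [L.IsRelational] [L.Structure A] [Finite A]
    (hN : ∀ n, L.Relations n → n < N + 1) :
    IsCoherent (L := L) (A := A) (switchEquiv hN) := by
  intro p₁ p₂ q h
  ext v
  change twist hN _ _ _ v = twist hN _ _ _ (twist hN _ _ _ v)
  rw [h.mid_eq, twist_twist, permExtension_comp h, h.dom_eq, h.cod_eq]

end Switching

/-! ### Making the extension clique faithful -/

section Valuations

variable {L : FirstOrder.Language.{u, v}} {A : Type w} {C : Type w'} [L.Structure A]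
  [L.Structure C]

/-- A set of points of an extension `C` of `A` is bad if no automorphism of `C` sends it into
`A`. -/
def IsBad (ι : A ↪[L] C) (S : Set C) : Prop := ¬ ∃ g : C ≃[L] C, g '' S ⊆ Set.range ι

/-- The points of the faithful extension: a point `x` of `C` with a value from a set of size
`|S| - 1` for each bad set `S` containing `x`. -/
def ValuedPoint (ι : A ↪[L] C) : Type w' :=
  Σ x : C, ∀ S : Set C, IsBad ι S → x ∈ S → Fin (S.ncard - 1)

variable {ι : A ↪[L] C}

instance [Finite C] : Finite (ValuedPoint ι) :=
  inferInstanceAs (Finite (Σ x : C, ∀ S : Set C, IsBad ι S → x ∈ S → Fin (S.ncard - 1)))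

theorem ValuedPoint.ext {u v : ValuedPoint ι} (h : u.1 = v.1)
    (h' : ∀ S hS hu hv, u.2 S hS hu = v.2 S hS hv) : u = v := by
  obtain ⟨x, χ⟩ := u
  obtain ⟨y, ξ⟩ := v
  obtain rfl : x = y := h
  refine congrArg (Sigma.mk x) ?_
  funext S hS hx
  exact h' S hS hx hx

theorem ValuedPoint.snd_congr {u v : ValuedPoint ι} (h : u = v) (S : Set C) (hS : IsBad ι S)
    (hu : u.1 ∈ S) (hv : v.1 ∈ S) : u.2 S hS hu = v.2 S hS hv := by
  subst h
  rfl

/-- Two valued points are compatible if they lie over distinct points and their values for each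
common bad set differ. The points of a pairwise compatible family cannot exhaust a bad set, for
lack of values. -/
def Compatible (u v : ValuedPoint ι) : Prop :=
  u.1 ≠ v.1 ∧ ∀ S hS hu hv, u.2 S hS hu ≠ v.2 S hS hv

/-- A tuple satisfies `R` if its projection to `C` does and its distinct entries are pairwise
compatible. -/
instance [L.IsRelational] : L.Structure (ValuedPoint ι) where
  funMap f := isEmptyElim f
  RelMap R v := RelMap R (fun i => (v i).1) ∧ ∀ i j, v i ≠ v j → Compatible (v i) (v j)

theorem ValuedPoint.relMap_iff [L.IsRelational] {n : ℕ} (R : L.Relations n)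
    (v : Fin n → ValuedPoint ι) :
    RelMap R v ↔ RelMap R (fun i => (v i).1) ∧ ∀ i j, v i ≠ v j → Compatible (v i) (v j) :=
  Iff.rfl

theorem IsBad.preimage {S : Set C} (hS : IsBad ι S) (g : C ≃[L] C) : IsBad ι (g ⁻¹' S) := by
  rintro ⟨h, hh⟩
  refine hS ⟨h.comp g.symm, ?_⟩
  rintro _ ⟨x, hx, rfl⟩
  refine hh ⟨g.symm x, ?_, rfl⟩
  simpa using hx

theorem not_isBad_image_of_pairwise [Finite C] {Q : Set (ValuedPoint ι)}
    (hQ : Q.Pairwise Compatible) : ¬ IsBad ι (Sigma.fst '' Q) := by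
  intro hbad
  have hinj : Set.InjOn Sigma.fst Q := fun u hu v hv h => by
    by_contra hne
    exact (hQ hu hv hne).1 h
  have hcard : (Sigma.fst '' Q).ncard = Q.ncard := hinj.ncard_image
  let f : Q → Fin ((Sigma.fst '' Q).ncard - 1) := fun u => u.1.2 _ hbad ⟨u.1, u.2, rfl⟩
  have hf : Function.Injective f := by
    intro u v h
    by_contra hne
    exact (hQ u.2 v.2 fun e => hne (Subtype.ext e)).2 _ hbad _ _ h
  have hle := Nat.card_le_card_of_injective f hf
  rw [Nat.card_fin, hcard] at hle
  change Q.ncard ≤ _ at hle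
  have h0 : Q = ∅ := (Set.ncard_eq_zero).1 (by omega)
  refine hbad ⟨FirstOrder.Language.Equiv.refl L C, ?_⟩
  rintro _ ⟨_, ⟨u, hu, -⟩, -⟩
  rw [h0] at hu
  exact hu.elim

theorem exists_value [Finite C] (ι : A ↪[L] C) (S : Set C) (hS : IsBad ι S) :
    ∃ f : {a : A // ι a ∈ S} → Fin (S.ncard - 1), Function.Injective f := by
  have hlt : (ι '' (ι ⁻¹' S)).ncard < S.ncard := by
    refine Set.ncard_lt_ncard ((Set.image_preimage_subset ι S).ssubset_of_ne fun h => hS ?_)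
    refine ⟨FirstOrder.Language.Equiv.refl L C, ?_⟩
    rintro _ ⟨x, hx, rfl⟩
    rw [← h] at hx
    exact Set.image_subset_range _ _ hx
  rw [Set.ncard_image_of_injective _ ι.injective] at hlt
  have : Finite A := Finite.of_injective ι ι.injective
  have hle : Nat.card {a : A // ι a ∈ S} ≤ S.ncard - 1 := Nat.le_sub_one_of_lt hlt
  exact ⟨Fin.castLE hle ∘ Finite.equivFin _,
    (Fin.castLE_injective hle).comp (Finite.equivFin _).injective⟩

/-- The copy in the faithful extension of an element of `A`. A bad set meets `A` in a proper
subset, which leaves room for distinct values on this subset. -/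
noncomputable def valuedPoint [Finite C] (ι : A ↪[L] C) (a : A) : ValuedPoint ι :=
  ⟨ι a, fun S hS ha => (exists_value ι S hS).choose ⟨a, ha⟩⟩

theorem valuedPoint_injective [Finite C] : Function.Injective (valuedPoint ι) :=
  fun _ _ h => ι.injective (congrArg Sigma.fst h)

theorem compatible_valuedPoint [Finite C] {a b : A} (h : a ≠ b) :
    Compatible (valuedPoint ι a) (valuedPoint ι b) :=
  ⟨fun e => h (ι.injective e), fun S hS _ _ e =>
    h (congrArg Subtype.val ((exists_value ι S hS).choose_spec e))⟩

/-- The inclusion of `A` into the faithful extension. -/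
noncomputable def valuedEmbedding [L.IsRelational] [Finite C] (ι : A ↪[L] C) :
    A ↪[L] ValuedPoint ι where
  toFun := valuedPoint ι
  inj' := valuedPoint_injective
  map_fun' f := isEmptyElim f
  map_rel' R t := by
    rw [ValuedPoint.relMap_iff]
    refine Iff.trans (and_iff_left ?_) (ι.map_rel R t)
    exact fun i j h => compatible_valuedPoint fun e => h (congrArg (valuedPoint ι) e)

/-- The relation `P` is the graph of a partial map over the automorphism `g` of `C`, and its domain
and its range consist of pairwise compatible points. -/
structure IsPartialLift (g : C ≃[L] C) (P : ValuedPoint ι → ValuedPoint ι → Prop) : Prop where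
  fst_eq : ∀ u v, P u v → v.1 = g u.1
  dom : (relDom P).Pairwise Compatible
  ran : (relRan P).Pairwise Compatible

/-- The partial map which a partial lift `P` of `g` prescribes between the values for the bad set
`g⁻¹(N)` and those for `N`. -/
def valueGraph (g : C ≃[L] C) (P : ValuedPoint ι → ValuedPoint ι → Prop) (N : Set C)
    (hN : IsBad ι N) (i : Fin ((g ⁻¹' N).ncard - 1)) (j : Fin (N.ncard - 1)) : Prop :=
  ∃ u v, P u v ∧ ∃ (hu : u.1 ∈ g ⁻¹' N) (hv : v.1 ∈ N),
    u.2 (g ⁻¹' N) (hN.preimage g) hu = i ∧ v.2 N hN hv = j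

theorem eq_of_pairwise_of_snd_eq {Q : Set (ValuedPoint ι)} (hQ : Q.Pairwise Compatible)
    {u v : ValuedPoint ι} (hu : u ∈ Q) (hv : v ∈ Q) {S : Set C} {hS : IsBad ι S} {huS : u.1 ∈ S}
    {hvS : v.1 ∈ S} (h : u.2 S hS huS = v.2 S hS hvS) : u = v := by
  by_contra hne
  exact (hQ hu hv hne).2 S hS huS hvS h

theorem eq_of_pairwise_of_fst_eq {Q : Set (ValuedPoint ι)} (hQ : Q.Pairwise Compatible)
    {u v : ValuedPoint ι} (hu : u ∈ Q) (hv : v ∈ Q) (h : u.1 = v.1) : u = v := by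
  by_contra hne
  exact (hQ hu hv hne).1 h

theorem IsPartialLift.valueGraph_biUnique {g : C ≃[L] C}
    {P : ValuedPoint ι → ValuedPoint ι → Prop} (hP : IsPartialLift g P) (N : Set C)
    (hN : IsBad ι N) : Relator.BiUnique (valueGraph g P N hN) := by
  constructor
  · rintro i i' j ⟨u, v, huv, hu, hv, rfl, rfl⟩ ⟨u', v', huv', hu', hv', rfl, e⟩
    obtain rfl := eq_of_pairwise_of_snd_eq hP.ran ⟨u', huv'⟩ ⟨u, huv⟩ e
    obtain rfl : u = u' := eq_of_pairwise_of_fst_eq hP.dom ⟨_, huv⟩ ⟨_, huv'⟩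
      (g.injective ((hP.fst_eq _ _ huv).symm.trans (hP.fst_eq _ _ huv')))
    rfl
  · rintro i j j' ⟨u, v, huv, hu, hv, rfl, rfl⟩ ⟨u', v', huv', hu', hv', e, rfl⟩
    obtain rfl := eq_of_pairwise_of_snd_eq hP.dom ⟨v', huv'⟩ ⟨v, huv⟩ e
    obtain rfl : v = v' := eq_of_pairwise_of_fst_eq hP.ran ⟨_, huv⟩ ⟨_, huv'⟩
      ((hP.fst_eq _ _ huv).trans (hP.fst_eq _ _ huv').symm)
    rfl

theorem ncard_preimage_equiv (g : C ≃[L] C) (N : Set C) : (g ⁻¹' N).ncard = N.ncard :=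
  Set.ncard_preimage_of_injective_subset_range g.injective
    (by rw [g.surjective.range_eq]; exact Set.subset_univ N)

/-- The bijection between the values for `g⁻¹(N)` and those for `N` which extends the one prescribed
by a partial lift of `g`. -/
noncomputable def valueEquiv {g : C ≃[L] C} {P : ValuedPoint ι → ValuedPoint ι → Prop}
    (hP : IsPartialLift g P) (N : Set C) (hN : IsBad ι N) :
    Fin ((g ⁻¹' N).ncard - 1) ≃ Fin (N.ncard - 1) :=
  rankExtension (valueGraph g P N hN) (hP.valueGraph_biUnique N hN)
    (by rw [ncard_preimage_equiv])

/-- The map over `g` which transports values by the bijections `valueEquiv`. -/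
noncomputable def liftFun {g : C ≃[L] C} {P : ValuedPoint ι → ValuedPoint ι → Prop}
    (hP : IsPartialLift g P) (v : ValuedPoint ι) : ValuedPoint ι :=
  ⟨g v.1, fun N hN hx => valueEquiv hP N hN (v.2 (g ⁻¹' N) (hN.preimage g) hx)⟩

theorem liftFun_eq {g : C ≃[L] C} {P : ValuedPoint ι → ValuedPoint ι → Prop}
    (hP : IsPartialLift g P) {u v : ValuedPoint ι} (h : P u v) : liftFun hP u = v := by
  refine ValuedPoint.ext (hP.fst_eq u v h).symm fun N hN hu hv => ?_
  exact (isRankExtension_rankExtension _ _).apply_eq _ _ ⟨u, v, h, hu, hv, rfl, rfl⟩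

theorem IsBad.exists_eq_preimage {S : Set C} (hS : IsBad ι S) (g : C ≃[L] C) :
    ∃ N, IsBad ι N ∧ S = g ⁻¹' N :=
  ⟨g.symm ⁻¹' S, hS.preimage g.symm, by ext x; simp⟩

theorem liftFun_injective {g : C ≃[L] C} {P : ValuedPoint ι → ValuedPoint ι → Prop}
    (hP : IsPartialLift g P) : Function.Injective (liftFun hP) := by
  intro u v h
  refine ValuedPoint.ext (g.injective (congrArg Sigma.fst h)) fun S hS hu hv => ?_
  obtain ⟨N, hN, rfl⟩ := hS.exists_eq_preimage g
  exact (valueEquiv hP N hN).injective (ValuedPoint.snd_congr h N hN hu hv)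

theorem compatible_liftFun {g : C ≃[L] C} {P : ValuedPoint ι → ValuedPoint ι → Prop}
    (hP : IsPartialLift g P) (u v : ValuedPoint ι) :
    Compatible (liftFun hP u) (liftFun hP v) ↔ Compatible u v := by
  refine and_congr (not_congr g.injective.eq_iff) ⟨fun h S hS hu hv e => ?_,
    fun h N hN hu hv e => ?_⟩
  · obtain ⟨N, hN, rfl⟩ := hS.exists_eq_preimage g
    exact h N hN hu hv (congrArg (valueEquiv hP N hN) e)
  · exact h (g ⁻¹' N) (hN.preimage g) hu hv ((valueEquiv hP N hN).injective e)

/-- A partial lift of an automorphism `g` of `C` extends to an automorphism over `g`. -/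
noncomputable def liftEquiv [L.IsRelational] [Finite C] {g : C ≃[L] C}
    {P : ValuedPoint ι → ValuedPoint ι → Prop} (hP : IsPartialLift g P) :
    ValuedPoint ι ≃[L] ValuedPoint ι where
  toEquiv := Equiv.ofBijective _ (Finite.injective_iff_bijective.1 (liftFun_injective hP))
  map_fun' f := isEmptyElim f
  map_rel' R v := by
    rw [ValuedPoint.relMap_iff, ValuedPoint.relMap_iff]
    refine and_congr (g.map_rel R fun i => (v i).1)
      (forall_congr' fun i => forall_congr' fun j => ?_)
    exact imp_congr (not_congr (liftFun_injective hP).eq_iff) (compatible_liftFun hP _ _)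

theorem liftFun_comp {g₁ g₂ : C ≃[L] C} {P₁ P₂ P : ValuedPoint ι → ValuedPoint ι → Prop}
    (h₁ : IsPartialLift g₁ P₁) (h₂ : IsPartialLift g₂ P₂) (h : IsPartialLift (g₁.comp g₂) P)
    (hmid : relRan P₂ = relDom P₁) (hcomp : P = Relation.Comp P₂ P₁) (u : ValuedPoint ι) :
    liftFun h u = liftFun h₁ (liftFun h₂ u) := by
  refine ValuedPoint.ext rfl fun N hN hu hv => ?_
  refine rankExtension_comp (G := valueGraph g₂ P₂ (g₁ ⁻¹' N) (hN.preimage g₁))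
    (H := valueGraph g₁ P₁ N hN) (K := valueGraph (g₁.comp g₂) P N hN) _ _ _ _ _ _ ?_ ?_ _
  · ext j
    constructor
    · rintro ⟨i, u, v, huv, hu, hv, rfl, rfl⟩
      obtain ⟨w, hw⟩ : v ∈ relDom P₁ := hmid ▸ ⟨u, huv⟩
      have hwN : w.1 ∈ N := by
        rw [h₁.fst_eq v w hw]
        exact hv
      exact ⟨_, v, w, hw, hv, hwN, rfl, rfl⟩
    · rintro ⟨k, v, w, hvw, hv, hw, rfl, rfl⟩
      obtain ⟨u, hu⟩ : v ∈ relRan P₂ := hmid ▸ ⟨w, hvw⟩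
      have huN : u.1 ∈ g₂ ⁻¹' (g₁ ⁻¹' N) := by
        rw [Set.mem_preimage, ← h₂.fst_eq u v hu]
        exact hv
      exact ⟨_, u, v, hu, huN, hv, rfl, rfl⟩
  · subst hcomp
    funext i k
    apply propext
    constructor
    · rintro ⟨u, w, ⟨v, huv, hvw⟩, hu, hw, rfl, rfl⟩
      have hv : v.1 ∈ g₁ ⁻¹' N := by
        rw [h₂.fst_eq u v huv]
        exact hu
      exact ⟨_, ⟨u, v, huv, hu, hv, rfl, rfl⟩, ⟨v, w, hvw, hv, hw, rfl, rfl⟩⟩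
    · rintro ⟨j, ⟨u, v, huv, hu, hv, rfl, rfl⟩, ⟨v', w, hvw, hv', hw, e, rfl⟩⟩
      obtain rfl := eq_of_pairwise_of_snd_eq h₁.dom ⟨w, hvw⟩ (hmid ▸ ⟨u, huv⟩) e
      exact ⟨u, w, ⟨v', huv, hvw⟩, hu, hw, rfl, rfl⟩

/-- The graph of a partial automorphism of `A`, carried to the copy of `A` in the faithful
extension. -/
def valuedGraph [Finite C] (ι : A ↪[L] C) (p : A ≃ₚ[L] A) (u v : ValuedPoint ι) : Prop :=
  ∃ a b, graph p a b ∧ valuedPoint ι a = u ∧ valuedPoint ι b = v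

theorem pairwise_compatible_of_subset_range [Finite C] {Q : Set (ValuedPoint ι)}
    (hQ : Q ⊆ Set.range (valuedPoint ι)) : Q.Pairwise Compatible := by
  intro u hu v hv hne
  obtain ⟨a, rfl⟩ := hQ hu
  obtain ⟨b, rfl⟩ := hQ hv
  exact compatible_valuedPoint fun e => hne (congrArg _ e)

theorem Extends.isPartialLift [Finite C] {p : A ≃ₚ[L] A} {g : C ≃[L] C} (h : Extends ι p g) :
    IsPartialLift g (valuedGraph ι p) where
  fst_eq := by
    rintro _ _ ⟨a, b, hab, rfl, rfl⟩
    exact (h.apply_eq hab).symm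
  dom := pairwise_compatible_of_subset_range fun _ ⟨_, a, _, _, ha, _⟩ => ⟨a, ha⟩
  ran := pairwise_compatible_of_subset_range fun _ ⟨_, _, b, _, _, hb⟩ => ⟨b, hb⟩

theorem IsCoherentTriple.relRan_valuedGraph [Finite C] {p₁ p₂ q : A ≃ₚ[L] A}
    (h : IsCoherentTriple p₁ p₂ q) :
    relRan (valuedGraph ι p₂) = relDom (valuedGraph ι p₁) := by
  ext v
  constructor
  · rintro ⟨_, a, b, hab, rfl, rfl⟩
    obtain ⟨c, hc⟩ : b ∈ relDom (graph p₁) := h.relRan_eq_relDom ▸ ⟨a, hab⟩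
    exact ⟨_, b, c, hc, rfl, rfl⟩
  · rintro ⟨_, b, c, hbc, rfl, rfl⟩
    obtain ⟨a, ha⟩ : b ∈ relRan (graph p₂) := h.relRan_eq_relDom ▸ ⟨c, hbc⟩
    exact ⟨_, a, b, ha, rfl, rfl⟩

theorem IsCoherentTriple.valuedGraph_eq [Finite C] {p₁ p₂ q : A ≃ₚ[L] A}
    (h : IsCoherentTriple p₁ p₂ q) :
    valuedGraph ι q = Relation.Comp (valuedGraph ι p₂) (valuedGraph ι p₁) := by
  funext u w
  apply propext
  constructor
  · rintro ⟨a, c, hac, rfl, rfl⟩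
    rw [h.graph_eq] at hac
    obtain ⟨b, hab, hbc⟩ := hac
    exact ⟨_, ⟨a, b, hab, rfl, rfl⟩, ⟨b, c, hbc, rfl, rfl⟩⟩
  · rintro ⟨_, ⟨a, b, hab, rfl, rfl⟩, ⟨b', c, hbc, e, rfl⟩⟩
    obtain rfl := valuedPoint_injective e
    refine ⟨a, c, ?_, rfl, rfl⟩
    rw [h.graph_eq]
    exact ⟨b', hab, hbc⟩

theorem extends_liftEquiv [L.IsRelational] [Finite C] {p : A ≃ₚ[L] A} {g : C ≃[L] C}
    (h : Extends ι p g) : Extends (valuedEmbedding ι) p (liftEquiv h.isPartialLift) :=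
  fun x => liftFun_eq h.isPartialLift ⟨x, p.toEquiv x, ⟨x.2, rfl⟩, rfl, rfl⟩

theorem isCoherent_liftEquiv [L.IsRelational] [Finite C] {φ : (A ≃ₚ[L] A) → (C ≃[L] C)}
    (hext : ∀ p, Extends ι p (φ p)) (hφ : IsCoherent φ) :
    IsCoherent fun p => liftEquiv (hext p).isPartialLift := by
  intro p₁ p₂ q h
  -- Generalizing `φ q` makes the equation `φ q = φ p₁ ∘ φ p₂`, on which types of values depend,
  -- available for substitution.
  have key : ∀ (g : C ≃[L] C) (hg : Extends ι q g), g = (φ p₁).comp (φ p₂) →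
      liftEquiv hg.isPartialLift =
        (liftEquiv (hext p₁).isPartialLift).comp (liftEquiv (hext p₂).isPartialLift) := by
    rintro _ hg rfl
    ext u
    exact liftFun_comp _ _ _ h.relRan_valuedGraph h.valuedGraph_eq u
  exact key (φ q) (hext q) (hφ p₁ p₂ q h)

theorem pairwise_compatible_of_isClique [L.IsRelational] {Q : Set (ValuedPoint ι)}
    (hQ : (gaifmanGraph L (ValuedPoint ι)).IsClique Q) : Q.Pairwise Compatible := by
  intro u hu v hv hne
  obtain ⟨-, n, R, a, ⟨i, rfl⟩, ⟨j, rfl⟩, hR⟩ := hQ hu hv hne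
  exact hR.2 i j hne

theorem isGaifmanCliqueFaithful_valuedEmbedding [L.IsRelational] [Finite C] (ι : A ↪[L] C) :
    IsGaifmanCliqueFaithful (valuedEmbedding ι) := by
  intro Q hQ
  have hcomp := pairwise_compatible_of_isClique hQ
  obtain ⟨g, hg⟩ := not_not.1 (not_isBad_image_of_pairwise hcomp)
  have hP : IsPartialLift (ι := ι) g
      fun u v => u ∈ Q ∧ ∃ a, ι a = g u.1 ∧ valuedPoint ι a = v := by
    refine ⟨?_, ?_, ?_⟩
    · rintro u _ ⟨-, a, ha, rfl⟩
      exact ha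
    · exact hcomp.mono fun _ ⟨_, hu, _⟩ => hu
    · exact pairwise_compatible_of_subset_range fun _ ⟨_, _, a, _, ha⟩ => ⟨a, ha⟩
  refine ⟨liftEquiv hP, ?_⟩
  rintro _ ⟨u, hu, rfl⟩
  obtain ⟨a, ha⟩ := hg ⟨u.1, ⟨u, hu, rfl⟩, rfl⟩
  exact ⟨a, (liftFun_eq hP ⟨hu, a, ha, rfl⟩).symm⟩

end Valuations

end CoherentEPPA

theorem theorem1p3 {L : FirstOrder.Language.{u, v}} [L.IsRelational]
    (hL : ∃ N : ℕ, ∀ n : ℕ, N < n → IsEmpty (L.Relations n))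
    (A : Type w) [L.Structure A] [Finite A] :
    ∃ (B : Type w) (_ : L.Structure B) (_ : Finite B) (ι : A ↪[L] B)
      (φ : (A ≃ₚ[L] A) → (B ≃[L] B)),
      (∀ p : A ≃ₚ[L] A, CoherentEPPA.Extends ι p (φ p)) ∧
      CoherentEPPA.IsCoherent φ ∧
      CoherentEPPA.IsGaifmanCliqueFaithful ι := by
  obtain ⟨N, hN⟩ := hL
  have hN' : ∀ n, L.Relations n → n < N + 1 := fun n R =>
    Nat.lt_succ_of_le (not_lt.1 fun h => (hN n h).false R)
  have hext := CoherentEPPA.extends_switchEquiv (A := A) hN'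
  exact ⟨CoherentEPPA.ValuedPoint (CoherentEPPA.switchEmbedding (A := A) hN'), inferInstance,
    inferInstance, CoherentEPPA.valuedEmbedding _,
    fun p => CoherentEPPA.liftEquiv (hext p).isPartialLift,
    fun p => CoherentEPPA.extends_liftEquiv (hext p),
    CoherentEPPA.isCoherent_liftEquiv hext (CoherentEPPA.isCoherent_switchEquiv hN'),
    CoherentEPPA.isGaifmanCliqueFaithful_valuedEmbedding _⟩
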